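/- Let $X$ be a real or complex Banach space and let $\mathcal D\subset X$ be a dictionary, that is, a set of unit vectors with dense linear span. For every $f\in X\setminus\{0\}$ fix a norming functional $F_f\in X^*$, i.e. $\|F_f\|=1$ and $F_f(f)=\|f\|$ (it is unique if the norm is smooth). Let $\Sigma_N$ be the set of all sums $\sum_{j=1}^N c_jg_j$ with $g_j\in\mathcal D$ and scalars $c_j$, and let $\sigma_N(f)=\inf_{a\in\Sigma_N}\|f-a\|$. Write $[\,\cdot\,]$ for the linear span. *Weak Chebyshev Greedy Algorithm (WCGA)* with weakness parameter $\tau\in(0,1]$: put $f_0=f$, $G_0f=0$. If $f_n\neq0$, pick any $\phi_{n+1}\in\mathcal D$ with $|F_{f_n}(\phi_{n+1})|\ge\tau\sup_{\phi\in\mathcal D}|F_{f_n}(\phi)|$, let $G_{n+1}f$ be any element of $[\phi_1,\dots,\phi_{n+1}]$ with $\|f-G_{n+1}f\|=\operatorname{dist}(f,[\phi_1,\dots,\phi_{n+1}])$, and put $f_{n+1}=f-G_{n+1}f$. If $f_n=0$, the algorithm stops, and $G_mf=G_nf$ for all $m\ge n$. *Properties.* - $(X,\mathcal D)$ has property $D(s,c_1)$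 if $\operatorname{dist}(f,[\phi])\le\|f\|\,(1-c_1|F_f(\phi)|^s)$ for all $f\in X\setminus\{0\}$ and all $\phi\in\mathcal D$. - $\Sigma_N$ has property $A3(r,V)$ if $\sum_{\phi\in A}|a_\phi|\le V|A|^r\,\big\|\sum_{\phi\in B}a_\phi\phi\big\|$ for all finite sets $A\subset B\subset\mathcal D$ with $|A|\le N$ and all scalars $a_\phi$. - $\Sigma_N$ has property $A2(U)$ if $\big\|\sum_{\phi\in A}a_\phi\phi\big\|\le U\,\big\|\sum_{\phi\in B}a_\phi\phi\big\|$ for all finite sets $A\subset B\subset\mathcal D$ with $|A|\le N$ and all scalars $a_\phi$. **Theorem.** There is a universal constant $C\ge1$, and for every $s>1$ a constant $C_2'(s)>0$ depending only on $s$, such that the following holds. Let $X$, $\mathcal D$ and $(F_f)_{f\ne0}$ be as above, and let $N\ge1$. Suppose that $(X,\mathcal D)$ has property $D(s,c_1)$ for some $c_1>0$, that $\Sigma_N$ has property $A3(r,V)$ for some $r\in(0,1]$ with $rs\ge1$ and some $V>0$, and that $\Sigma_N$ has property $A2(U)$ for some $U\ge1$. Then for every $\tau\in(0,1]$, every $f\in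 X$ and every realization of the WCGA with parameter $\tau$ applied to $f$, $$\|f-G_{\phi(N)}f\|\le C\,\sigma_N(f),\qquad \phi(N)=\Big\lfloor C_2'(s)\,c_1^{-1}\,\tau^{-s}\,\log(U+1)\,V^s\,N^{rs}\Big\rfloor .$$ -/

import Mathlib

namespace ChebyshevGreedy

variable {𝕜 : Type*} [RCLike 𝕜] {X : Type*} [NormedAddCommGroup X] [NormedSpace 𝕜 X]

variable (𝕜) in
/-- A dictionary: a set of unit vectors whose linear span is dense. -/
structure IsDictionary (D : Set X) : Prop where
  norm_eq_one : ∀ φ ∈ D, ‖φ‖ = 1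
  dense_span : Dense (Submodule.span 𝕜 D : Set X)

/-- `F` selects, for every `f ≠ 0`, a norming functional `F f` of `f`. -/
def IsNormingSelection (F : X → (X →L[𝕜] 𝕜)) : Prop :=
  ∀ f : X, f ≠ 0 → ‖F f‖ = 1 ∧ F f f = ((‖f‖ : ℝ) : 𝕜)

variable (𝕜) in
/-- The set `Σ_N(D)` of `N`-sparse elements with respect to `D`. -/
def sparse (D : Set X) (N : ℕ) : Set X :=
  {x | ∃ (g : Fin N → X) (c : Fin N → 𝕜), (∀ j, g j ∈ D) ∧ x = ∑ j, c j • g j}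

variable (𝕜) in
/-- The error `σ_N(f, D)` of best `N`-term approximation. -/
noncomputable def bestError (D : Set X) (N : ℕ) (f : X) : ℝ :=
  ⨅ a : sparse 𝕜 D N, ‖f - (a : X)‖

variable (𝕜) in
/-- `Σ_K` has property `A2(U)`. -/
def PropertyA2 (D : Set X) (K : ℕ) (U : ℝ) : Prop :=
  ∀ A B : Finset X, A ⊆ B → (B : Set X) ⊆ D → A.card ≤ K → ∀ a : X → 𝕜,
    ‖∑ φ ∈ A, a φ • φ‖ ≤ U * ‖∑ φ ∈ B, a φ • φ‖

variable (𝕜) in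
/-- `Σ_K` has property `A3(r, V)`. -/
def PropertyA3 (D : Set X) (K : ℕ) (r V : ℝ) : Prop :=
  ∀ A B : Finset X, A ⊆ B → (B : Set X) ⊆ D → A.card ≤ K → ∀ a : X → 𝕜,
    ∑ φ ∈ A, ‖a φ‖ ≤ V * (A.card : ℝ) ^ r * ‖∑ φ ∈ B, a φ • φ‖

/-- Property `D(s, c₁)`, relative to the norming functionals `F f`. -/
def PropertyD (F : X → (X →L[𝕜] 𝕜)) (D : Set X) (s c₁ : ℝ) : Prop :=
  ∀ f : X, f ≠ 0 → ∀ φ ∈ D,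
    Metric.infDist f (Submodule.span 𝕜 {φ} : Set X) ≤ ‖f‖ * (1 - c₁ * ‖F f φ‖ ^ s)

/-- `(φ, G)` is a realization of the Weak Chebyshev Greedy Algorithm with weakness parameter `τ`
applied to `f`: `φ n` is the dictionary element picked at step `n + 1`, and `G n` is the
approximant after `n` steps, so that the remainder is `f - G n`. If a remainder vanishes, the
algorithm stops and the approximant no longer changes. -/
structure IsWCGA (F : X → (X →L[𝕜] 𝕜)) (D : Set X) (τ : ℝ) (f : X)
    (φ : ℕ → X) (G : ℕ → X) : Prop where
  zero : G 0 = 0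
  mem : ∀ n, f - G n ≠ 0 → φ n ∈ D
  /-- The weak greedy condition `|F (φ n)| ≥ τ sup_{ψ ∈ D} |F ψ|`. -/
  greedy : ∀ n, f - G n ≠ 0 → ∀ ψ ∈ D, τ * ‖F (f - G n) ψ‖ ≤ ‖F (f - G n) (φ n)‖
  mem_span : ∀ n, f - G n ≠ 0 → G (n + 1) ∈ Submodule.span 𝕜 (φ '' Set.Iic n)
  dist_eq : ∀ n, f - G n ≠ 0 →
    ‖f - G (n + 1)‖ = Metric.infDist f (Submodule.span 𝕜 (φ '' Set.Iic n) : Set X)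
  terminated : ∀ n, f - G n = 0 → G (n + 1) = G n

end ChebyshevGreedy

/-!
Fix a sparse element `g = ∑ ψ ∈ T, x ψ • ψ` with error `ε = ‖f - g‖`, and let `T_k` be the part of
`T` that is not picked in the first `k` steps. The aim is a remainder of norm at most `5 * ε`.

*Decay.* Property `D` forces the norming functional of a remainder to vanish on everything already
picked (`IsWCGA.apply_eq_zero`). Hence, if `A ⊆ T_k` and the tail of `g` over `T_k \ A` has norm at
most `t`, then a remainder larger than `2 * (t + ε)` is normed essentially by the combination over
`A`, whose coefficients are controlled by A3. The functional is therefore at least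
`1 / (3 * V * |A| ^ r)` at some dictionary element (`IsWCGA.exists_le_norm_apply`), and each step
gains a fixed factor that depends on `|A|` but not on `N` (`IsWCGA.norm_add_le_of_log_le`).

*One phase* (`IsWCGA.exists_phase`). Let `β j` be the smallest tail norm that can be reached by
removing at most `2 ^ j / 2` elements from `T_k`, and let `l` be the first index at which `β` drops
by the factor `4 * U`. Up to `l` the sequence decreases slowly, so `O(log (4 * U))` decay times at
each of the scales `2 ^ 0, …, 2 ^ l` bring the remainder to `2 * (β l / (4 * U) + ε)`. Since
`r * s ≥ 1`, the last scale dominates the cost. If at most `2 ^ l / 2` elements of `T_k` were picked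
meanwhile, what is left of `T_k` has tail norm at least `β l`, and A2 bounds that norm by `U` times
the remainder plus `ε`. The two bounds on `β l` give `β l ≤ 6 * U * ε`, and the remainder is at most
`5 * ε`. Otherwise more than `2 ^ l / 2` elements of `T_k` were picked, at a cost proportional to
the `r * s`-th power of their number.

*Iteration* (`IsWCGA.exists_le_five_mul`). As `r * s ≥ 1`, the costs of the phases add up to at most
the cost of picking all of `T` at once. This is why only `log (U + 1)` enters the number of steps,
and not the ratio of `‖f‖` to `ε`.
-/

namespace ChebyshevGreedy

section Algorithm

variable {𝕜 : Type*} [RCLike 𝕜] {X : Type*} [NormedAddCommGroup X] [NormedSpace 𝕜 X]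
  {F : X → (X →L[𝕜] 𝕜)} {D : Set X} {τ : ℝ} {f : X} {φ G : ℕ → X}

/-! ### The remainders of the algorithm -/

theorem IsWCGA.mem_span_Iio (h : IsWCGA F D τ f φ G) (n : ℕ) :
    G n ∈ Submodule.span 𝕜 (φ '' Set.Iio n) := by
  induction n with
  | zero => simp [h.zero]
  | succ n ih =>
    by_cases h0 : f - G n = 0
    · rw [h.terminated n h0]
      exact Submodule.span_mono (Set.image_mono (Set.Iio_subset_Iio n.le_succ)) ih
    · have := h.mem_span n h0
      rwa [← Set.Iio_add_one_eq_Iic] at this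

/-- The approximants are best approximations even after the algorithm has stopped. -/
theorem IsWCGA.norm_le (h : IsWCGA F D τ f φ G) (n : ℕ) {y : X}
    (hy : y ∈ Submodule.span 𝕜 (φ '' Set.Iio n)) : ‖f - G n‖ ≤ ‖f - y‖ := by
  cases n with
  | zero =>
    have : y = 0 := by simpa using hy
    rw [h.zero, this]
  | succ n =>
    by_cases h0 : f - G n = 0
    · rw [h.terminated n h0, h0, norm_zero]
      exact norm_nonneg _
    · rw [h.dist_eq n h0, ← dist_eq_norm]
      rw [Set.Iio_add_one_eq_Iic] at hy
      exact Metric.infDist_le_dist_of_mem hy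

theorem IsWCGA.antitone_norm (h : IsWCGA F D τ f φ G) : Antitone fun n => ‖f - G n‖ :=
  antitone_nat_of_succ_le fun n => h.norm_le (n + 1)
    (Submodule.span_mono (Set.image_mono (Set.Iio_subset_Iio n.le_succ)) (h.mem_span_Iio n))

theorem IsWCGA.mem_of_lt (h : IsWCGA F D τ f φ G) {n i : ℕ} (hn : f - G n ≠ 0) (hi : i < n) :
    φ i ∈ D := by
  refine h.mem i fun h0 => hn ?_
  have := h.antitone_norm hi.le
  simp only [h0, norm_zero] at this
  exact norm_le_zero_iff.1 this

/-- Without any smoothness of the norm, property `D` forces the norming functional of a remainder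
to vanish on the elements picked so far: such an element cannot improve the remainder. -/
theorem IsWCGA.apply_eq_zero (h : IsWCGA F D τ f φ G) {s c₁ : ℝ} (hc : 0 < c₁)
    (hD : PropertyD F D s c₁) {n i : ℕ} (hn : f - G n ≠ 0) (hi : i < n) :
    F (f - G n) (φ i) = 0 := by
  have h1 := hD _ hn _ (h.mem_of_lt hn hi)
  have h2 : ‖f - G n‖ ≤ Metric.infDist (f - G n) (Submodule.span 𝕜 {φ i} : Set X) := by
    refine (Metric.le_infDist ⟨0, Submodule.zero_mem _⟩).2 fun {y} hy => ?_
    rw [dist_eq_norm, sub_sub]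
    refine h.norm_le n (Submodule.add_mem _ (h.mem_span_Iio n) ?_)
    refine Submodule.span_mono ?_ hy
    rintro _ rfl
    exact ⟨i, hi, rfl⟩
  have hpos : 0 < ‖f - G n‖ := norm_pos_iff.2 hn
  by_contra hF
  have h3 : 0 < ‖f - G n‖ * (c₁ * ‖F (f - G n) (φ i)‖ ^ s) := by
    have : 0 < ‖F (f - G n) (φ i)‖ := norm_pos_iff.2 hF
    positivity
  linarith

theorem IsWCGA.norm_succ_le (h : IsWCGA F D τ f φ G) {s c₁ : ℝ} (hs : 0 < s) (hc : 0 < c₁)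
    (hτ : 0 < τ) (hD : PropertyD F D s c₁) {n : ℕ} (hn : f - G n ≠ 0) {S : ℝ} (hS : 0 ≤ S)
    {ψ : X} (hψ : ψ ∈ D) (hSψ : S ≤ ‖F (f - G n) ψ‖) :
    ‖f - G (n + 1)‖ ≤ ‖f - G n‖ * (1 - c₁ * (τ * S) ^ s) := by
  have h1 := hD _ hn _ (h.mem n hn)
  have h2 : ‖f - G (n + 1)‖ ≤ Metric.infDist (f - G n) (Submodule.span 𝕜 {φ n} : Set X) := by
    refine (Metric.le_infDist ⟨0, Submodule.zero_mem _⟩).2 fun {y} hy => ?_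
    rw [dist_eq_norm, sub_sub]
    refine h.norm_le (n + 1) (Submodule.add_mem _ ?_ ?_)
    · exact Submodule.span_mono (Set.image_mono (Set.Iio_subset_Iio n.le_succ)) (h.mem_span_Iio n)
    · refine Submodule.span_mono ?_ hy
      rintro _ rfl
      exact ⟨n, Nat.lt_succ_self n, rfl⟩
  have h3 : (τ * S) ^ s ≤ ‖F (f - G n) (φ n)‖ ^ s :=
    Real.rpow_le_rpow (by positivity)
      ((mul_le_mul_of_nonneg_left hSψ hτ.le).trans (h.greedy n hn ψ hψ)) hs.le
  refine (h2.trans h1).trans ?_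
  gcongr

open Classical in
/-- The dictionary elements picked in the first `n` steps. -/
noncomputable def picked {Y : Type*} (φ : ℕ → Y) (n : ℕ) : Finset Y := (Finset.range n).image φ

theorem mem_picked {Y : Type*} {φ : ℕ → Y} {n : ℕ} {ψ : Y} :
    ψ ∈ picked φ n ↔ ∃ i < n, φ i = ψ := by
  simp [picked]

theorem coe_picked {Y : Type*} (φ : ℕ → Y) (n : ℕ) : (picked φ n : Set Y) = φ '' Set.Iio n := by
  ext ψ; simp [mem_picked]

theorem picked_mono {Y : Type*} (φ : ℕ → Y) : Monotone (picked φ) := fun m n hmn ψ hψ => by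
  obtain ⟨i, hi, rfl⟩ := mem_picked.1 hψ
  exact mem_picked.2 ⟨i, hi.trans_le hmn, rfl⟩

/-! ### Consequences of A2 and A3 for the part of a sparse element not yet picked -/

open Classical in
/-- Subtracting an element of `span P` from a combination over `T` leaves the coefficients on
`T \ P` unchanged. -/
theorem exists_coeff_sub {T P : Finset X} (x : X → 𝕜) {y : X}
    (hy : y ∈ Submodule.span 𝕜 (P : Set X)) :
    ∃ a : X → 𝕜, (∀ ψ ∈ T \ P, a ψ = x ψ) ∧
      ∑ ψ ∈ T ∪ P, a ψ • ψ = ∑ ψ ∈ T, x ψ • ψ - y := by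
  obtain ⟨d, hd, rfl⟩ := Submodule.mem_span_finset.1 hy
  have hd0 : ∀ ψ, ψ ∉ P → d ψ = 0 := fun ψ hψ => by
    by_contra h0
    exact hψ (hd h0)
  refine ⟨fun ψ => (if ψ ∈ T then x ψ else 0) - d ψ, fun ψ hψ => ?_, ?_⟩
  · rw [Finset.mem_sdiff] at hψ
    simp [hψ.1, hd0 ψ hψ.2]
  · simp only [sub_smul, Finset.sum_sub_distrib]
    congr 1
    · rw [← Finset.sum_subset (Finset.subset_union_left (s₁ := T) (s₂ := P))]
      · exact Finset.sum_congr rfl fun ψ hψ => by simp [hψ]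
      · intro ψ _ hψ
        simp [hψ]
    · rw [← Finset.sum_subset (Finset.subset_union_right (s₁ := T) (s₂ := P))]
      intro ψ _ hψ
      simp [hd0 ψ hψ]

theorem IsWCGA.picked_subset (h : IsWCGA F D τ f φ G) {n : ℕ} (hn : f - G n ≠ 0) :
    (picked φ n : Set X) ⊆ D := fun ψ hψ => by
  obtain ⟨i, hi, rfl⟩ := mem_picked.1 hψ
  exact h.mem_of_lt hn hi

open Classical in
/-- The difference of the sparse element and the `n`-th approximant, written over the dictionary so
that A2 and A3 apply to it: the coefficients of the unpicked elements are those of the sparse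
element. -/
theorem IsWCGA.exists_coeff (h : IsWCGA F D τ f φ G) (T : Finset X) (x : X → 𝕜) (n : ℕ) :
    ∃ a : X → 𝕜, (∀ ψ ∈ T \ picked φ n, a ψ = x ψ) ∧
      ‖∑ ψ ∈ T ∪ picked φ n, a ψ • ψ‖ ≤ ‖f - G n‖ + ‖f - ∑ ψ ∈ T, x ψ • ψ‖ := by
  obtain ⟨a, ha, hsum⟩ := exists_coeff_sub (T := T) (P := picked φ n) x
    (y := G n) (by rw [coe_picked]; exact h.mem_span_Iio n)
  refine ⟨a, ha, ?_⟩
  rw [hsum, ← sub_sub_sub_cancel_left _ _ f]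
  exact norm_sub_le _ _

open Classical in
theorem IsWCGA.sum_norm_coeff_le (h : IsWCGA F D τ f φ G) {N : ℕ} {r V : ℝ} (hV : 0 < V)
    (hA3 : PropertyA3 𝕜 D N r V) {n : ℕ} (hn : f - G n ≠ 0)
    {T A : Finset X} (hT : (T : Set X) ⊆ D) (hTN : T.card ≤ N) (x : X → 𝕜)
    (hA : A ⊆ T \ picked φ n) :
    ∑ ψ ∈ A, ‖x ψ‖ ≤ V * (A.card : ℝ) ^ r * (‖f - G n‖ + ‖f - ∑ ψ ∈ T, x ψ • ψ‖) := by
  obtain ⟨a, ha, hsum⟩ := h.exists_coeff T x n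
  have hAT : A ⊆ T := hA.trans Finset.sdiff_subset
  have hB : ((T ∪ picked φ n : Finset X) : Set X) ⊆ D := by
    rw [Finset.coe_union]
    exact Set.union_subset hT (h.picked_subset hn)
  rw [← Finset.sum_congr rfl fun ψ hψ => congrArg norm (ha ψ (hA hψ))]
  refine (hA3 A _ (hAT.trans Finset.subset_union_left) hB
    ((Finset.card_le_card hAT).trans hTN) a).trans ?_
  gcongr

open Classical in
theorem IsWCGA.norm_sum_sdiff_le (h : IsWCGA F D τ f φ G) {N : ℕ} {U : ℝ} (hU : 0 ≤ U)
    (hA2 : PropertyA2 𝕜 D N U) {n : ℕ} (hn : f - G n ≠ 0)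
    {T : Finset X} (hT : (T : Set X) ⊆ D) (hTN : T.card ≤ N) (x : X → 𝕜) :
    ‖∑ ψ ∈ T \ picked φ n, x ψ • ψ‖ ≤ U * (‖f - G n‖ + ‖f - ∑ ψ ∈ T, x ψ • ψ‖) := by
  obtain ⟨a, ha, hsum⟩ := h.exists_coeff T x n
  have hB : ((T ∪ picked φ n : Finset X) : Set X) ⊆ D := by
    rw [Finset.coe_union]
    exact Set.union_subset hT (h.picked_subset hn)
  rw [← Finset.sum_congr rfl fun ψ hψ => congrArg (· • ψ) (ha ψ hψ)]
  refine (hA2 _ _ (Finset.sdiff_subset.trans Finset.subset_union_left) hB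
    ((Finset.card_le_card Finset.sdiff_subset).trans hTN) a).trans ?_
  gcongr

open Classical in
/-- The remainder is at most the unpicked part of the sparse element plus the approximation error,
since the picked part belongs to the span over which the algorithm minimizes. -/
theorem IsWCGA.norm_le_norm_sum_add (h : IsWCGA F D τ f φ G) (T : Finset X) (x : X → 𝕜) (n : ℕ) :
    ‖f - G n‖ ≤ ‖∑ ψ ∈ T \ picked φ n, x ψ • ψ‖ + ‖f - ∑ ψ ∈ T, x ψ • ψ‖ := by
  have hy : ∑ ψ ∈ T ∩ picked φ n, x ψ • ψ ∈ Submodule.span 𝕜 (φ '' Set.Iio n) := by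
    rw [← coe_picked]
    exact Submodule.sum_mem _ fun ψ hψ => Submodule.smul_mem _ _
      (Submodule.subset_span (Finset.mem_inter.1 hψ).2)
  refine (h.norm_le n hy).trans ?_
  have hsplit : f - ∑ ψ ∈ T ∩ picked φ n, x ψ • ψ =
      ∑ ψ ∈ T \ picked φ n, x ψ • ψ + (f - ∑ ψ ∈ T, x ψ • ψ) := by
    rw [← Finset.sum_inter_add_sum_sdiff T (picked φ n)]
    abel
  rw [hsplit]
  exact norm_add_le _ _

/-! ### Decay of the remainders -/

open Classical in
/-- As long as the remainder dominates the tail `∑ x ψ • ψ` over the unpicked indices outside `A`,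
its norming functional acts essentially on the combination over `A`. Since A3 bounds the `ℓ¹` norm
of the coefficients over `A`, the functional is large at some dictionary element. -/
theorem IsWCGA.exists_le_norm_apply (h : IsWCGA F D τ f φ G) (hF : IsNormingSelection F)
    {s c₁ : ℝ} (hc : 0 < c₁) (hD : PropertyD F D s c₁) {N : ℕ} {r V : ℝ} (hr : 0 < r)
    (hV : 0 < V) (hA3 : PropertyA3 𝕜 D N r V) {T : Finset X} (hT : (T : Set X) ⊆ D)
    (hTN : T.card ≤ N) (x : X → 𝕜) {k n : ℕ} (hkn : k ≤ n) {A : Finset X}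
    (hA : A ⊆ T \ picked φ k) {a t ε : ℝ} (ha : 0 < a) (hAa : (A.card : ℝ) ≤ a)
    (ht : ‖∑ ψ ∈ (T \ picked φ k) \ A, x ψ • ψ‖ ≤ t) (hε : ‖f - ∑ ψ ∈ T, x ψ • ψ‖ ≤ ε)
    (hn : 2 * (t + ε) < ‖f - G n‖) :
    ∃ ψ ∈ D, 1 / (3 * V * a ^ r) ≤ ‖F (f - G n) ψ‖ := by
  by_contra! hcon
  have ht0 : 0 ≤ t := (norm_nonneg _).trans ht
  have hε0 : 0 ≤ ε := (norm_nonneg _).trans hε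
  have hn0 : f - G n ≠ 0 := norm_pos_iff.1 (by linarith)
  obtain ⟨hF1, hF2⟩ := hF _ hn0
  set Φ := F (f - G n) with hΦ
  have hpick : ∀ ψ ∈ picked φ n, Φ ψ = 0 := fun ψ hψ => by
    obtain ⟨i, hi, rfl⟩ := mem_picked.1 hψ
    exact h.apply_eq_zero hc hD hn0 hi
  have hle : ∀ y, ‖Φ y‖ ≤ ‖y‖ := fun y => by simpa [hF1] using Φ.le_opNorm y
  have hG : Φ (G n) = 0 := by
    have : Submodule.span 𝕜 (φ '' Set.Iio n) ≤ LinearMap.ker (Φ : X →ₗ[𝕜] 𝕜) := by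
      rw [Submodule.span_le, ← coe_picked]
      exact fun ψ hψ => hpick ψ hψ
    exact this (h.mem_span_Iio n)
  have hΦsum : ∀ B : Finset X, Φ (∑ ψ ∈ B, x ψ • ψ) = ∑ ψ ∈ B, x ψ * Φ ψ := fun B => by
    simp [map_sum]
  have hf : f - G n = (f - ∑ ψ ∈ T, x ψ • ψ) + (∑ ψ ∈ (T \ picked φ k) \ A, x ψ • ψ)
      + (∑ ψ ∈ A \ picked φ n, x ψ • ψ) + (∑ ψ ∈ A ∩ picked φ n, x ψ • ψ)
      + (∑ ψ ∈ T ∩ picked φ k, x ψ • ψ) - G n := by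
    rw [← Finset.sum_inter_add_sum_sdiff T (picked φ k), ← Finset.sum_sdiff hA,
      ← Finset.sum_inter_add_sum_sdiff A (picked φ n)]
    abel
  have h1 : ∑ ψ ∈ A ∩ picked φ n, x ψ * Φ ψ = 0 := Finset.sum_eq_zero fun ψ hψ => by
    rw [hpick ψ (Finset.mem_inter.1 hψ).2, mul_zero]
  have h2 : ∑ ψ ∈ T ∩ picked φ k, x ψ * Φ ψ = 0 := Finset.sum_eq_zero fun ψ hψ => by
    rw [hpick ψ (picked_mono φ hkn (Finset.mem_inter.1 hψ).2), mul_zero]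
  have h3 : ‖f - G n‖ = ‖Φ (f - ∑ ψ ∈ T, x ψ • ψ)
      + Φ (∑ ψ ∈ (T \ picked φ k) \ A, x ψ • ψ) + Φ (∑ ψ ∈ A \ picked φ n, x ψ • ψ)‖ := by
    have h4 : ‖Φ (f - G n)‖ = ‖f - G n‖ := by rw [hF2]; simp
    rw [← h4]
    conv_lhs => rw [hf]
    rw [map_sub, map_add, map_add, map_add, map_add, hG, hΦsum (A ∩ _), h1, hΦsum (T ∩ _), h2]
    simp
  have h5 : ‖Φ (∑ ψ ∈ A \ picked φ n, x ψ • ψ)‖ ≤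
      1 / (3 * V * a ^ r) * ∑ ψ ∈ A \ picked φ n, ‖x ψ‖ := by
    rw [hΦsum, Finset.mul_sum]
    refine (norm_sum_le _ _).trans (Finset.sum_le_sum fun ψ hψ => ?_)
    rw [norm_mul, mul_comm]
    have hψA := hA (Finset.mem_sdiff.1 hψ).1
    exact mul_le_mul_of_nonneg_right (hcon ψ (hT (Finset.mem_sdiff.1 hψA).1)).le (norm_nonneg _)
  have hsub : A \ picked φ n ⊆ T \ picked φ n :=
    Finset.sdiff_subset_sdiff (hA.trans Finset.sdiff_subset) le_rfl
  have h6 := h.sum_norm_coeff_le hV hA3 hn0 hT hTN x hsub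
  have hcard : ((A \ picked φ n).card : ℝ) ^ r ≤ a ^ r := by
    refine Real.rpow_le_rpow (by positivity) (le_trans ?_ hAa) hr.le
    exact_mod_cast Finset.card_le_card Finset.sdiff_subset
  have h7 : ∑ ψ ∈ A \ picked φ n, ‖x ψ‖ ≤ V * a ^ r * (‖f - G n‖ + ε) := by
    refine h6.trans ?_
    gcongr
  have h8 : ‖Φ (∑ ψ ∈ A \ picked φ n, x ψ • ψ)‖ ≤ (‖f - G n‖ + ε) / 3 := by
    refine (h5.trans (mul_le_mul_of_nonneg_left h7 (by positivity))).trans_eq ?_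
    have : a ^ r ≠ 0 := (Real.rpow_pos_of_pos ha r).ne'
    field_simp
  have h9 := norm_add₃_le (a := Φ (f - ∑ ψ ∈ T, x ψ • ψ))
    (b := Φ (∑ ψ ∈ (T \ picked φ k) \ A, x ψ • ψ)) (c := Φ (∑ ψ ∈ A \ picked φ n, x ψ • ψ))
  have h10 := hle (f - ∑ ψ ∈ T, x ψ • ψ)
  have h11 := hle (∑ ψ ∈ (T \ picked φ k) \ A, x ψ • ψ)
  linarith

open Classical in
/-- While the remainder exceeds `2 * (t + ε)` it decays geometrically, so that `m` steps with
`m * y ≥ log b` bring it from `2 * (b * t + ε)` to `2 * (t + ε)`. -/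
theorem IsWCGA.norm_add_le_of_log_le (h : IsWCGA F D τ f φ G) (hF : IsNormingSelection F)
    {s c₁ : ℝ} (hs : 0 < s) (hc : 0 < c₁) (hτ : 0 < τ) (hD : PropertyD F D s c₁) {N : ℕ}
    {r V : ℝ} (hr : 0 < r) (hV : 0 < V) (hA3 : PropertyA3 𝕜 D N r V) {T : Finset X}
    (hT : (T : Set X) ⊆ D) (hTN : T.card ≤ N) (x : X → 𝕜) {k n : ℕ} (hkn : k ≤ n)
    {A : Finset X} (hA : A ⊆ T \ picked φ k) {a t ε b : ℝ} (ha : 0 < a)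
    (hAa : (A.card : ℝ) ≤ a) (ht : ‖∑ ψ ∈ (T \ picked φ k) \ A, x ψ • ψ‖ ≤ t)
    (hε : ‖f - ∑ ψ ∈ T, x ψ • ψ‖ ≤ ε) (hb : 1 ≤ b) (hn : ‖f - G n‖ ≤ 2 * (b * t + ε)) {m : ℕ}
    (hm : Real.log b ≤ m * (c₁ * (τ * (1 / (3 * V * a ^ r))) ^ s)) :
    ‖f - G (n + m)‖ ≤ 2 * (t + ε) := by
  by_contra! hcon
  have ht0 : 0 ≤ t := (norm_nonneg _).trans ht
  have hε0 : 0 ≤ ε := (norm_nonneg _).trans hε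
  set y := c₁ * (τ * (1 / (3 * V * a ^ r))) ^ s with hy
  have hdecay : ∀ i ≤ m, ‖f - G (n + i)‖ ≤ ‖f - G n‖ * Real.exp (-(i * y)) := by
    intro i hi
    induction i with
    | zero => simp
    | succ i ih =>
      have hlarge : 2 * (t + ε) < ‖f - G (n + i)‖ :=
        hcon.trans_le (h.antitone_norm (by omega : n + i ≤ n + m))
      obtain ⟨ψ, hψ, hψS⟩ := h.exists_le_norm_apply hF hc hD hr hV hA3 hT hTN x
        (hkn.trans (Nat.le_add_right n i)) hA ha hAa ht hε hlarge
      have hstep := h.norm_succ_le hs hc hτ hD (norm_pos_iff.1 (by linarith))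
        (by positivity) hψ hψS
      calc ‖f - G (n + (i + 1))‖ ≤ ‖f - G (n + i)‖ * (1 - y) := hstep
        _ ≤ ‖f - G (n + i)‖ * Real.exp (-y) :=
            mul_le_mul_of_nonneg_left (by linarith [Real.add_one_le_exp (-y)]) (norm_nonneg _)
        _ ≤ ‖f - G n‖ * Real.exp (-(i * y)) * Real.exp (-y) :=
            mul_le_mul_of_nonneg_right (ih (by omega)) (Real.exp_pos _).le
        _ = ‖f - G n‖ * Real.exp (-((i + 1 : ℕ) * y)) := by
            rw [mul_assoc, ← Real.exp_add]
            push_cast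
            ring_nf
  have hb0 : 0 < b := by linarith
  have hexp : Real.exp (-(m * y)) ≤ b⁻¹ := by
    rw [← Real.exp_log (inv_pos.2 hb0), Real.log_inv]
    exact Real.exp_le_exp.2 (by linarith)
  have h1 : ‖f - G (n + m)‖ ≤ 2 * (b * t + ε) * b⁻¹ :=
    (hdecay m le_rfl).trans (mul_le_mul hn hexp (Real.exp_pos _).le (by positivity))
  have h2 : 2 * (b * t + ε) * b⁻¹ = 2 * (t + ε * b⁻¹) := by field_simp
  have h3 : ε * b⁻¹ ≤ ε := mul_le_of_le_one_right hε0 (inv_le_one_of_one_le₀ hb)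
  linarith

/-! ### One phase of the algorithm -/

/-- Used with `p` elements left: a sequence that vanishes once all of them may be removed drops by
the factor `b` at some step, and the first such step occurs while `2 ^ l / 2 < p`. -/
theorem exists_first_drop {β : ℕ → ℝ} {b : ℝ} (hβ : ∀ j, 0 ≤ β j) {p : ℕ}
    (hp : ∀ j, p ≤ 2 ^ j / 2 → β j = 0) (hp0 : 0 < p) :
    ∃ l, b * β (l + 1) ≤ β l ∧ (∀ j < l, β j ≤ b * β (j + 1)) ∧ 2 ^ l / 2 < p := by
  have hex : ∃ l, b * β (l + 1) ≤ β l := by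
    refine ⟨p, ?_⟩
    have : p ≤ 2 ^ (p + 1) / 2 := by
      rw [pow_succ, Nat.mul_div_cancel _ two_pos]
      exact Nat.lt_two_pow_self.le
    rw [hp _ this, mul_zero]
    exact hβ p
  refine ⟨Nat.find hex, Nat.find_spec hex, fun j hj => (not_le.1 (Nat.find_min hex hj)).le, ?_⟩
  by_contra! hcon
  obtain hl | ⟨j, hl⟩ : Nat.find hex = 0 ∨ ∃ j, Nat.find hex = j + 1 := by
    rcases Nat.find hex with _ | j
    exacts [Or.inl rfl, Or.inr ⟨j, rfl⟩]
  · rw [hl] at hcon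
    simp at hcon
    omega
  · refine Nat.find_min hex (m := j) (by omega) ?_
    rw [← hl, hp _ hcon, mul_zero]
    exact hβ j

theorem sum_pow_le_pow {q : ℝ} (hq : 2 ≤ q) (n : ℕ) : ∑ i ∈ Finset.range n, q ^ i ≤ q ^ n := by
  induction n with
  | zero => simp
  | succ n ih =>
    rw [Finset.sum_range_succ, pow_succ]
    nlinarith [pow_pos (show (0 : ℝ) < q by linarith) n]

theorem PropertyD.const_le_one {s c₁ : ℝ} (hD : PropertyD F D s c₁)
    (hF : IsNormingSelection F) {ψ : X} (hψ : ψ ∈ D) (hψ1 : ‖ψ‖ = 1) : c₁ ≤ 1 := by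
  have h0 : ψ ≠ 0 := norm_pos_iff.1 (by simp [hψ1])
  have h1 := hD ψ h0 ψ hψ
  have h2 : ‖F ψ ψ‖ = 1 := by simp [(hF ψ h0).2, hψ1]
  rw [h2, hψ1, Real.one_rpow] at h1
  have h3 := Metric.infDist_nonneg (x := ψ) (s := (Submodule.span 𝕜 {ψ} : Set X))
  linarith

theorem PropertyA3.one_le_const {N : ℕ} {r V : ℝ} (hA3 : PropertyA3 𝕜 D N r V) (hN : 1 ≤ N)
    {ψ : X} (hψ : ψ ∈ D) (hψ1 : ‖ψ‖ = 1) : 1 ≤ V := by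
  simpa [hψ1] using hA3 {ψ} {ψ} le_rfl (by simpa using hψ) (by simpa using hN) fun _ => 1

open Classical in
/-- Let `p` be the number of elements of `T` that are not yet picked after `k` steps. There is
`1 ≤ δ ≤ p` such that a number of steps proportional to `δ ^ (r * s)` either brings the remainder
to at most `5 * ε` or picks at least `δ` of these `p` elements. -/
theorem IsWCGA.exists_phase (h : IsWCGA F D τ f φ G) (hF : IsNormingSelection F)
    (hD1 : ∀ ψ ∈ D, ‖ψ‖ = 1) {s c₁ : ℝ} (hs : 0 < s) (hc : 0 < c₁) (hτ : 0 < τ) (hτ1 : τ ≤ 1)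
    (hD : PropertyD F D s c₁) {N : ℕ} (hN : 1 ≤ N) {r V U : ℝ} (hr : 0 < r) (hrs : 1 ≤ r * s)
    (hV : 0 < V) (hU : 1 ≤ U) (hA3 : PropertyA3 𝕜 D N r V) (hA2 : PropertyA2 𝕜 D N U)
    {T : Finset X} (hT : (T : Set X) ⊆ D) (hTN : T.card ≤ N) (x : X → 𝕜) {ε : ℝ}
    (hε : ‖f - ∑ ψ ∈ T, x ψ • ψ‖ ≤ ε) {k : ℕ} (hk : 0 < (T \ picked φ k).card) :
    ∃ m δ : ℕ, δ ≠ 0 ∧ δ ≤ (T \ picked φ k).card ∧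
      (m : ℝ) ≤ 4 * Real.log (4 * U) * ((3 * V) ^ s / (c₁ * τ ^ s)) * (4 * δ : ℝ) ^ (r * s) ∧
      (‖f - G (k + m)‖ ≤ 5 * ε ∨
        (T \ picked φ (k + m)).card + δ ≤ (T \ picked φ k).card) := by
  set T' := T \ picked φ k with hT'
  obtain ⟨ψ₀, hψ₀⟩ := Finset.card_pos.1 hk
  have hψ₀D : ψ₀ ∈ D := hT (Finset.mem_sdiff.1 hψ₀).1
  have hc1 : c₁ ≤ 1 := hD.const_le_one hF hψ₀D (hD1 _ hψ₀D)
  have hV1 : 1 ≤ V := hA3.one_le_const hN hψ₀D (hD1 _ hψ₀D)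
  have hε0 : 0 ≤ ε := (norm_nonneg _).trans hε
  -- `A j` leaves the smallest tail among the sets of at most `2 ^ j / 2` elements (none if `j = 0`).
  have hmin : ∀ j : ℕ, ∃ A ⊆ T', A.card ≤ 2 ^ j / 2 ∧ ∀ B ⊆ T', B.card ≤ 2 ^ j / 2 →
      ‖∑ ψ ∈ T' \ A, x ψ • ψ‖ ≤ ‖∑ ψ ∈ T' \ B, x ψ • ψ‖ := by
    intro j
    obtain ⟨A, hA, hAmin⟩ := Finset.exists_min_image
      (T'.powerset.filter fun B => B.card ≤ 2 ^ j / 2) (fun B => ‖∑ ψ ∈ T' \ B, x ψ • ψ‖)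
      ⟨∅, by simp⟩
    rw [Finset.mem_filter, Finset.mem_powerset] at hA
    exact ⟨A, hA.1, hA.2, fun B hB hBc =>
      hAmin B (Finset.mem_filter.2 ⟨Finset.mem_powerset.2 hB, hBc⟩)⟩
  choose A hAT hAc hAmin using hmin
  set β : ℕ → ℝ := fun j => ‖∑ ψ ∈ T' \ A j, x ψ • ψ‖ with hβ
  have hβ0 : ∀ j, 0 ≤ β j := fun j => norm_nonneg _
  have hβp : ∀ j, T'.card ≤ 2 ^ j / 2 → β j = 0 := fun j hj =>
    le_antisymm ((hAmin j T' le_rfl hj).trans_eq (by simp)) (hβ0 j)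
  obtain ⟨l, hl, hlt, hlp⟩ := exists_first_drop (b := 4 * U) hβ0 hβp hk
  set q : ℝ := 2 ^ (r * s) with hq
  have hq2 : 2 ≤ q := by
    simpa using Real.rpow_le_rpow_of_exponent_le one_le_two hrs
  set K : ℝ := Real.log (4 * U) * ((3 * V) ^ s / (c₁ * τ ^ s)) with hK
  have hK1 : 1 ≤ K := by
    have h1 : 1 ≤ Real.log (4 * U) := by
      rw [Real.le_log_iff_exp_le (by linarith)]
      linarith [Real.exp_one_lt_d9]
    have h2 : 1 ≤ (3 * V) ^ s := Real.one_le_rpow (by linarith) hs.le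
    have h3 : c₁ * τ ^ s ≤ 1 :=
      mul_le_one₀ hc1 (by positivity) (Real.rpow_le_one hτ.le hτ1 hs.le)
    exact one_le_mul_of_one_le_of_one_le h1 ((one_le_div (by positivity)).2 (h3.trans h2))
  have hqpow : ∀ j : ℕ, ((2 : ℝ) ^ j) ^ (r * s) = q ^ j := fun j => by
    rw [hq, ← Real.rpow_natCast, ← Real.rpow_natCast, ← Real.rpow_mul two_pos.le,
      ← Real.rpow_mul two_pos.le, mul_comm]
  have hmj : ∀ j : ℕ, Real.log (4 * U) ≤
      (⌈K * q ^ j⌉₊ : ℝ) * (c₁ * (τ * (1 / (3 * V * ((2 : ℝ) ^ j) ^ r))) ^ s) := by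
    intro j
    have h1 : K * q ^ j * (c₁ * (τ * (1 / (3 * V * ((2 : ℝ) ^ j) ^ r))) ^ s) =
        Real.log (4 * U) := by
      rw [← hqpow, Real.rpow_mul (by positivity), Real.mul_rpow hτ.le (by positivity),
        one_div, Real.inv_rpow (by positivity), Real.mul_rpow (by positivity) (by positivity), hK]
      have : ((2 : ℝ) ^ j) ^ r > 0 := by positivity
      field_simp
    rw [← h1]
    gcongr
    exact Nat.le_ceil _
  set M : ℕ → ℕ := fun j => ∑ i ∈ Finset.range j, ⌈K * q ^ i⌉₊ with hM
  -- One application of the decay estimate, with the tail `β (j + 1)` replaced by a larger `t`.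
  have hstage : ∀ (j : ℕ) (t : ℝ), β (j + 1) ≤ t → ‖f - G (k + M j)‖ ≤ 2 * (4 * U * t + ε) →
      ‖f - G (k + M (j + 1))‖ ≤ 2 * (t + ε) := by
    intro j t ht hn
    have hcard : ((A (j + 1)).card : ℝ) ≤ 2 ^ j := by
      have := hAc (j + 1)
      rw [pow_succ, Nat.mul_div_cancel _ two_pos] at this
      exact_mod_cast this
    have hMs : k + M (j + 1) = k + M j + ⌈K * q ^ j⌉₊ := by
      rw [add_assoc]
      exact congrArg (k + ·) (Finset.sum_range_succ _ _)
    rw [hMs]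
    exact h.norm_add_le_of_log_le hF hs hc hτ hD hr hV hA3 hT hTN x (Nat.le_add_right _ _)
      (hAT (j + 1)) (by positivity) hcard ht hε (by linarith) hn (hmj j)
  have hstages : ∀ j ≤ l, ‖f - G (k + M j)‖ ≤ 2 * (β j + ε) := by
    intro j hj
    induction j with
    | zero =>
      have h1 := h.norm_le_norm_sum_add T x k
      have h2 : A 0 = ∅ := Finset.card_eq_zero.1 (by simpa using hAc 0)
      have h3 : β 0 = ‖∑ ψ ∈ T', x ψ • ψ‖ := by simp [hβ, h2]
      rw [← hT', ← h3] at h1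
      simp only [hM, Finset.range_zero, Finset.sum_empty, add_zero]
      linarith [hβ0 0]
    | succ j ih =>
      refine hstage j _ le_rfl ((ih (by omega)).trans ?_)
      linarith [hlt j (by omega)]
  have hlast : ‖f - G (k + M (l + 1))‖ ≤ 2 * (β l / (4 * U) + ε) := by
    refine hstage l _ ((le_div_iff₀' (by linarith)).2 hl) ((hstages l le_rfl).trans_eq ?_)
    rw [mul_div_cancel₀ _ (by linarith)]
  refine ⟨M (l + 1), 2 ^ l / 2 + 1, Nat.succ_ne_zero _, hlp, ?_, ?_⟩
  · have h1 : ∀ i, (⌈K * q ^ i⌉₊ : ℝ) ≤ 2 * K * q ^ i := fun i => by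
      have h2 : 1 ≤ K * q ^ i :=
        one_le_mul_of_one_le_of_one_le hK1 (one_le_pow₀ (by linarith))
      linarith [Nat.ceil_lt_add_one (zero_le_one.trans h2)]
    have h3 : (2 : ℝ) ^ (l + 1) ≤ 4 * ((2 ^ l / 2 + 1 : ℕ) : ℝ) := by
      have : 2 ^ (l + 1) ≤ 4 * (2 ^ l / 2 + 1) := by
        rw [pow_succ]
        omega
      exact_mod_cast this
    calc (M (l + 1) : ℝ) ≤ ∑ i ∈ Finset.range (l + 1), 2 * K * q ^ i := by
          rw [hM]
          push_cast
          exact Finset.sum_le_sum fun i _ => h1 i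
      _ ≤ 2 * K * q ^ (l + 1) := by
          rw [← Finset.mul_sum]
          exact mul_le_mul_of_nonneg_left (sum_pow_le_pow hq2 _) (by linarith)
      _ ≤ 2 * K * (4 * ((2 ^ l / 2 + 1 : ℕ) : ℝ)) ^ (r * s) := by
          rw [← hqpow]
          gcongr
      _ ≤ _ := by
          rw [mul_assoc 4 (Real.log _), ← hK]
          gcongr
          norm_num
  · -- If at most `2 ^ l / 2` elements were picked, they compete with `A l`, and A2 bounds the tail
    -- that remains by the remainder.
    by_cases hpick : 2 ^ l / 2 + 1 ≤ (T' ∩ picked φ (k + M (l + 1))).card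
    · right
      have h1 := Finset.card_inter_add_card_sdiff T' (picked φ (k + M (l + 1)))
      have h2 : T' \ picked φ (k + M (l + 1)) = T \ picked φ (k + M (l + 1)) := by
        ext ψ
        have := @picked_mono _ φ k (k + M (l + 1)) (Nat.le_add_right _ _) ψ
        simp only [hT', Finset.mem_sdiff]
        tauto
      rw [h2] at h1
      omega
    · left
      by_cases hn0 : f - G (k + M (l + 1)) = 0
      · rw [hn0, norm_zero]
        positivity
      have h1 := hAmin l (T' ∩ picked φ (k + M (l + 1))) Finset.inter_subset_left (by omega)
      have h2 : T' \ (T' ∩ picked φ (k + M (l + 1))) = T \ picked φ (k + M (l + 1)) := by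
        ext ψ
        have := @picked_mono _ φ k (k + M (l + 1)) (Nat.le_add_right _ _) ψ
        simp only [hT', Finset.mem_sdiff, Finset.mem_inter]
        tauto
      rw [h2] at h1
      have h3 := h.norm_sum_sdiff_le (by linarith) hA2 hn0 hT hTN x
      have h4 : β l ≤ U * (2 * (β l / (4 * U) + ε) + ε) := by
        refine h1.trans (h3.trans ?_)
        gcongr
      have h5 : U * (2 * (β l / (4 * U) + ε) + ε) = β l / 2 + 3 * U * ε := by
        have : U ≠ 0 := by linarith
        field_simp
        ring
      have h6 : β l / (4 * U) ≤ 3 / 2 * ε := by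
        rw [div_le_iff₀ (by linarith)]
        linarith
      linarith

/-! ### Iterating the phases -/

open Classical in
/-- Induction over the number of unpicked elements. The costs `δ ^ (r * s)` of the phases add up
because `u ↦ u ^ (r * s)` is superadditive. -/
theorem IsWCGA.exists_le_five_mul (h : IsWCGA F D τ f φ G) (hF : IsNormingSelection F)
    (hD1 : ∀ ψ ∈ D, ‖ψ‖ = 1) {s c₁ : ℝ} (hs : 0 < s) (hc : 0 < c₁) (hτ : 0 < τ) (hτ1 : τ ≤ 1)
    (hD : PropertyD F D s c₁) {N : ℕ} (hN : 1 ≤ N) {r V U : ℝ} (hr : 0 < r) (hrs : 1 ≤ r * s)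
    (hV : 0 < V) (hU : 1 ≤ U) (hA3 : PropertyA3 𝕜 D N r V) (hA2 : PropertyA2 𝕜 D N U)
    {T : Finset X} (hT : (T : Set X) ⊆ D) (hTN : T.card ≤ N) (x : X → 𝕜) (k : ℕ) :
    ∃ m : ℕ, (m : ℝ) ≤ 4 * Real.log (4 * U) * ((3 * V) ^ s / (c₁ * τ ^ s)) *
        (4 * (T \ picked φ k).card : ℝ) ^ (r * s) ∧
      ‖f - G (k + m)‖ ≤ 5 * ‖f - ∑ ψ ∈ T, x ψ • ψ‖ := by
  induction hp : (T \ picked φ k).card using Nat.strong_induction_on generalizing k with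
  | _ p ih =>
  have hlog : 0 ≤ Real.log (4 * U) := Real.log_nonneg (by linarith)
  obtain rfl | hp0 := Nat.eq_zero_or_pos p
  · refine ⟨0, by push_cast; positivity, ?_⟩
    have := h.norm_le_norm_sum_add T x k
    rw [Finset.card_eq_zero.1 hp, Finset.sum_empty, norm_zero] at this
    rw [add_zero]
    linarith [norm_nonneg (f - ∑ ψ ∈ T, x ψ • ψ)]
  obtain ⟨m, δ, hδ0, hδ, hm, hcase⟩ := h.exists_phase hF hD1 hs hc hτ hτ1 hD hN hr hrs hV hU hA3 hA2
    hT hTN x le_rfl (k := k) (hp ▸ hp0)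
  rw [hp] at hδ hcase
  obtain hdone | hdrop := hcase
  · refine ⟨m, hm.trans ?_, hdone⟩
    gcongr
  · obtain ⟨m', hm', hle⟩ := ih _ (by omega) (k + m) rfl
    refine ⟨m + m', ?_, by rwa [← add_assoc]⟩
    set p' := (T \ picked φ (k + m)).card
    have hsuper : (4 * δ : ℝ) ^ (r * s) + (4 * p' : ℝ) ^ (r * s) ≤ (4 * p : ℝ) ^ (r * s) := by
      have h1 : (p' : ℝ) + δ ≤ p := by exact_mod_cast hdrop
      have h2 := NNReal.coe_le_coe.2
        (NNReal.add_rpow_le_rpow_add (4 * δ : NNReal) (4 * p' : NNReal) hrs)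
      push_cast at h2
      exact h2.trans (Real.rpow_le_rpow (by positivity) (by linarith) (by linarith))
    push_cast
    refine (add_le_add hm hm').trans ?_
    rw [← mul_add]
    gcongr

open Classical in
/-- An `N`-sparse element is a combination over a set of at most `N` distinct elements. -/
theorem exists_finset_of_mem_sparse {N : ℕ} {y : X} (hy : y ∈ sparse 𝕜 D N) :
    ∃ (T : Finset X) (x : X → 𝕜), (T : Set X) ⊆ D ∧ T.card ≤ N ∧ y = ∑ ψ ∈ T, x ψ • ψ := by
  obtain ⟨g, c, hg, rfl⟩ := hy
  refine ⟨Finset.univ.image g, fun ψ => ∑ j with g j = ψ, c j, ?_, ?_, ?_⟩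
  · intro ψ hψ
    obtain ⟨j, -, rfl⟩ := Finset.mem_image.1 hψ
    exact hg j
  · exact Finset.card_image_le.trans (by simp)
  · rw [← Finset.sum_fiberwise_of_maps_to (g := g) (t := Finset.univ.image g)
      fun j hj => Finset.mem_image_of_mem g hj]
    refine Finset.sum_congr rfl fun ψ _ => ?_
    rw [Finset.sum_smul]
    refine Finset.sum_congr rfl fun j hj => ?_
    rw [(Finset.mem_filter.1 hj).2]

theorem log_four_mul_le {U : ℝ} (hU : 1 ≤ U) : Real.log (4 * U) ≤ 2 * Real.log (U + 1) := by
  have h : Real.log ((U + 1) ^ 2) = 2 * Real.log (U + 1) := by simp [Real.log_pow]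
  rw [← h]
  exact Real.log_le_log (by linarith) (by nlinarith [sq_nonneg (U - 1)])

end Algorithm

end ChebyshevGreedy

theorem mainTheorem1 :
    ∃ C : ℝ, 1 ≤ C ∧ ∀ s : ℝ, 1 < s → ∃ C₂ : ℝ, 0 < C₂ ∧
      ∀ (𝕜 : Type*) [RCLike 𝕜] (X : Type*) [NormedAddCommGroup X] [NormedSpace 𝕜 X]
        [CompleteSpace X] (D : Set X) (F : X → (X →L[𝕜] 𝕜)),
        ChebyshevGreedy.IsDictionary 𝕜 D →
        ChebyshevGreedy.IsNormingSelection F →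
        ∀ (N : ℕ) (c₁ r V U : ℝ), 1 ≤ N → 0 < c₁ → 0 < r → r ≤ 1 → 1 ≤ r * s → 0 < V → 1 ≤ U →
          ChebyshevGreedy.PropertyD F D s c₁ →
          ChebyshevGreedy.PropertyA3 𝕜 D N r V →
          ChebyshevGreedy.PropertyA2 𝕜 D N U →
          ∀ τ : ℝ, 0 < τ → τ ≤ 1 →
            ∀ (f : X) (φ G : ℕ → X), ChebyshevGreedy.IsWCGA F D τ f φ G →
              ‖f - G ⌊C₂ * c₁⁻¹ * τ ^ (-s) * Real.log (U + 1) * V ^ s * (N : ℝ) ^ (r * s)⌋₊‖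
                ≤ C * ChebyshevGreedy.bestError 𝕜 D N f := by
  refine ⟨5, by norm_num, fun s hs => ⟨8 * 12 ^ s, by positivity, ?_⟩⟩
  classical
  intro 𝕜 _ X _ _ _ D F hDict hF N c₁ r V U hN hc hr hr1 hrs hV hU hD hA3 hA2 τ hτ hτ1 f φ G h
  obtain rfl | ⟨ψ₀, hψ₀⟩ := D.eq_empty_or_nonempty
  · -- An empty dictionary is dense only in the zero space.
    have hzero : ∀ y : X, y = 0 := fun y => by
      have := hDict.dense_span y
      rwa [Submodule.span_empty, Submodule.bot_coe, closure_singleton] at this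
    rw [hzero (f - G _), norm_zero]
    exact mul_nonneg (by norm_num) (Real.iInf_nonneg fun _ => norm_nonneg _)
  have hne : Nonempty (ChebyshevGreedy.sparse 𝕜 D N) :=
    ⟨_, fun _ => ψ₀, fun _ => 0, fun _ => hψ₀, rfl⟩
  rw [← div_le_iff₀' (by norm_num)]
  refine le_ciInf fun a => ?_
  obtain ⟨T, x, hT, hTN, ha⟩ := ChebyshevGreedy.exists_finset_of_mem_sparse a.2
  obtain ⟨m, hm, hle⟩ := h.exists_le_five_mul hF hDict.norm_eq_one (by linarith) hc hτ hτ1 hD hN hr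
    hrs hV hU hA3 hA2 hT hTN x 0
  rw [div_le_iff₀' (by norm_num), ha]
  rw [zero_add] at hle
  refine (h.antitone_norm (Nat.le_floor (hm.trans ?_))).trans hle
  have hlog : 0 ≤ Real.log (U + 1) := Real.log_nonneg (by linarith)
  have hpicked : ChebyshevGreedy.picked φ 0 = ∅ := rfl
  have h1 : (4 * (T.card : ℝ)) ^ (r * s) ≤ 4 ^ s * (N : ℝ) ^ (r * s) := by
    rw [Real.mul_rpow (by norm_num) (by positivity)]
    gcongr
    · norm_num
    · nlinarith
  rw [hpicked, Finset.sdiff_empty]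
  calc _ ≤ 4 * (2 * Real.log (U + 1)) * ((3 * V) ^ s / (c₁ * τ ^ s)) *
        (4 ^ s * (N : ℝ) ^ (r * s)) := by
        gcongr
        exact ChebyshevGreedy.log_four_mul_le hU
    _ = _ := by
        rw [Real.mul_rpow (by norm_num) hV.le, Real.rpow_neg hτ.le,
          show (12 : ℝ) = 3 * 4 by norm_num, Real.mul_rpow (by norm_num) (by norm_num)]
        field_simp
        ring
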